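/- **Proposition 4.6 (First upper bound on stability levels).** For a finite simple graph $G$ with vertex set $[n]$ and edge set $E$, and $h>0$, consider spin configurations $\sigma\in\{-1,+1\}^n$ with Hamiltonian $$H(\sigma)=-\sum_{\{i,j\}\in E}\sigma_i\sigma_j-h\sum_{i\in[n]}\sigma_i ,$$ and let $\boxminus$, $\boxplus$ be the all-minus and all-plus configurations. A path from $\sigma$ to $\sigma'$ is a sequence $\omega=(\omega_0=\sigma,\omega_1,\dots,\omega_\ell=\sigma')$, $\ell\ge 1$, of configurations in which consecutive ones differ in exactly one spin. Put $$\Phi(\sigma,\sigma')=\min_{\omega:\sigma\to\sigma'}\ \max_{\sigma''\in\omega}H(\sigma''),\qquad V_\sigma=\min_{\sigma':\,H(\sigma')<H(\sigma)}\Phi(\sigma,\sigma')-H(\sigma)$$ (with $V_\sigma=\infty$ if no such $\sigma'$ exists), and let $$i_e(G)=\min_{\varnothing\ne A\subset[n],\ |A|\le n/2}\frac{|\partial_eA|}{|A|},$$ where $\partial_eA$ is the set of edges between $A$ and its complement. 1. Let $G$ be a connected $r$-regular graph on $n$ vertices and let $0<h<i_e(G)$. Exclude the case in which $G$ is the complete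 graph, $n$ is odd and $h(n-2)\le 2$. Then, for all $\sigma\notin\{\boxminus,\boxplus\}$, $$V_\sigma\le 2(r-2+h)\left\lceil\frac{r+h-2i_e(G)}{r-h}\,\frac n2\right\rceil .$$ 2. There are absolute constants $C_0>0$ and $C_2<\infty$ such that, for every fixed integer $r\ge 3$ and every fixed $h$ with $0<h<C_0\sqrt r$, the following holds for a graph $G_n$ chosen uniformly at random from all simple $r$-regular graphs with vertex set $[n]$: with probability tending to one as $n\to\infty$ along the integers with $nr$ even, $$V_\sigma\le\left(\frac r2+C_2\sqrt r\right)n\qquad\text{for all }\sigma\notin\{\boxminus,\boxplus\}.$$ -/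

import Mathlib

namespace RegularIsing

/-- Spin configurations `σ ∈ {-1,+1}^V`; the elements of `ℤˣ` are exactly `1` and `-1`. -/
abbrev Config (V : Type*) := V → ℤˣ

/-- The all minus configuration. -/
def allMinus (V : Type*) : Config V := fun _ => -1

/-- The all plus configuration. -/
def allPlus (V : Type*) : Config V := fun _ => 1

/-- The edge boundary of `A`: the edges `(i, j)` with `i ∈ A` and `j ∉ A`
(each edge of the boundary is listed once, starting from its endpoint in `A`). -/
noncomputable def edgeBoundary {V : Type*} [Fintype V] [DecidableEq V]
    (G : SimpleGraph V) (A : Finset V) : Finset (V × V) :=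
  open Classical in G.interedges A Aᶜ

/-- The isoperimetric number: the minimum of `|∂A| / |A|` over all nonempty vertex sets `A` with
`|A| ≤ n / 2` (the minimum of a finite set, nonempty as soon as `n ≥ 2`). -/
noncomputable def isoNumber {V : Type*} [Fintype V] [DecidableEq V] (G : SimpleGraph V) : ℝ :=
  sInf {x : ℝ | ∃ A : Finset V, A.Nonempty ∧ 2 * A.card ≤ Fintype.card V ∧
    x = ((edgeBoundary G A).card : ℝ) / (A.card : ℝ)}

/-- The product `σ_i σ_j` of the spins at the two ends of the edge `{i, j}`. -/
def edgeProd {V : Type*} (σ : Config V) : Sym2 V → ℝ :=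
  Sym2.lift ⟨fun i j => ((σ i : ℤ) : ℝ) * ((σ j : ℤ) : ℝ), fun _ _ => mul_comm _ _⟩

/-- The Ising Hamiltonian with interaction constant `J = 1` and external field `h`:
`H(σ) = - ∑_{(i,j) ∈ E} σ_i σ_j - h ∑_i σ_i`. -/
noncomputable def energy {V : Type*} [Fintype V] [DecidableEq V]
    (G : SimpleGraph V) (h : ℝ) (σ : Config V) : ℝ :=
  open Classical in
  -(∑ e ∈ G.edgeFinset, edgeProd σ e) - h * ∑ i, ((σ i : ℤ) : ℝ)

/-- `ω 0, …, ω ℓ` is a path of length `ℓ ≥ 1` from `σ` to `τ`: consecutive configurations differ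
in exactly one spin. -/
def IsPath {V : Type*} [Fintype V] (σ τ : Config V) (ℓ : ℕ) (ω : Fin (ℓ + 1) → Config V) : Prop :=
  1 ≤ ℓ ∧ ω 0 = σ ∧ ω (Fin.last ℓ) = τ ∧
    ∀ k : Fin ℓ, hammingDist (ω k.castSucc) (ω k.succ) = 1

/-- The communication height `Φ(σ, τ) = min_{ω : σ → τ} max_{σ'' ∈ ω} H(σ'')`. The values lie in
the finite range of `H`, so the infimum is a minimum whenever a path exists. -/
noncomputable def commHeight {V : Type*} [Fintype V] [DecidableEq V]
    (G : SimpleGraph V) (h : ℝ) (σ τ : Config V) : EReal :=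
  ⨅ (ℓ : ℕ) (ω : Fin (ℓ + 1) → Config V) (_ : IsPath σ τ ℓ ω),
    ⨆ k : Fin (ℓ + 1), (energy G h (ω k) : EReal)

/-- The stability level `V_σ = min_{σ' : H(σ') < H(σ)} Φ(σ, σ') - H(σ)`, which is `∞` if there is
no configuration of smaller energy. -/
noncomputable def stabilityLevel {V : Type*} [Fintype V] [DecidableEq V]
    (G : SimpleGraph V) (h : ℝ) (σ : Config V) : EReal :=
  ⨅ (τ : Config V) (_ : energy G h τ < energy G h σ),
    commHeight G h σ τ - (energy G h σ : EReal)

/-- The set of all simple `r`-regular graphs with vertex set `{0, …, n - 1}`. -/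
def regularGraphs (n r : ℕ) : Set (SimpleGraph (Fin n)) :=
  {G | open Classical in G.IsRegularOfDegree r}

/-- The probability of the event `E` for a uniformly chosen simple `r`-regular graph on `n`
vertices. -/
noncomputable def regularProb (n r : ℕ) (E : Set (SimpleGraph (Fin n))) : ℝ :=
  ((regularGraphs n r ∩ E).ncard : ℝ) / ((regularGraphs n r).ncard : ℝ)

/-- The sequence of events `E n` holds with high probability: the probability tends to one as
`n → ∞` along those `n` for which `n * r` is even. -/
def Whp (r : ℕ) (E : (n : ℕ) → Set (SimpleGraph (Fin n))) : Prop :=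
  Filter.Tendsto (fun n => regularProb n r (E n))
    (Filter.atTop ⊓ Filter.principal {n : ℕ | Even (n * r)}) (nhds 1)

end RegularIsing

/-! Empty the set `B` of vertices carrying spin `s` one vertex at a time, always removing the vertex
that leaves the smallest cut. The path ends at a constant configuration. The energy change after `j`
steps is twice the cut growth plus `2hsj`, so everything reduces to bounding the cut along the
greedy chain. Two bounds do this. By connectivity, each step adds at most `r - 2` to the cut. By
averaging over the removed vertex, the greedy chain keeps at least the expected number of internal
edges of a random subset (`cut_greedyChain_le`), which gives a concave quadratic bound in `j`. Part
1: take `s` with `|B| ≤ n/2`. The endpoint is lower because `cut B ≥ i_e |B| > h |B|`. With `K` the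
ceiling in the statement, connectivity covers `j ≤ K`, and the quadratic bound covers `j > K`
(`height_inequality`). If `r + h - 2 i_e ≤ 0`, no step raises the energy, and it remains to see that
`K ≥ 0` (`stepBound_nonneg`). Degrees 1 and 2 are treated by hand. Part 2: for `s = -1` the field
helps, so `cut B ≥ 0` suffices, and the quadratic bound gives height at most `r(n + 2)/2` on every
`r`-regular graph. Randomness plays no role beyond the existence of such graphs. -/

namespace RegularIsing

open Finset

set_option linter.unusedSectionVars false

/-! ### Adjacency as a real-valued indicator -/

section Indicator

variable {V : Type*} (G : SimpleGraph V)

/-- The real adjacency indicator. -/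
noncomputable def adjInd (u v : V) : ℝ :=
  open Classical in if G.Adj u v then 1 else 0

variable {G}

lemma adjInd_comm (u v : V) : adjInd G u v = adjInd G v u := by
  by_cases h : G.Adj u v
  · simp [adjInd, h, h.symm]
  · have h' : ¬G.Adj v u := fun h' => h h'.symm
    simp [adjInd, h, h']

lemma adjInd_self (u : V) : adjInd G u u = 0 := by simp [adjInd]

lemma adjInd_nonneg (u v : V) : 0 ≤ adjInd G u v := by
  unfold adjInd; split_ifs <;> norm_num

lemma adjInd_of_adj {u v : V} (h : G.Adj u v) : adjInd G u v = 1 := by simp [adjInd, h]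

lemma one_le_sum_adjInd {v w : V} {S : Finset V} (hw : w ∈ S) (h : G.Adj v w) :
    1 ≤ ∑ x ∈ S, adjInd G v x := by
  rw [← adjInd_of_adj h]
  exact Finset.single_le_sum (f := fun x => adjInd G v x) (fun x _ => adjInd_nonneg v x) hw

end Indicator

/-! ### Edge cuts and their change under removal of a vertex -/

section Cut

variable {V : Type*} [Fintype V] [DecidableEq V] (G : SimpleGraph V)

/-- The size of the edge boundary, as a real number. -/
noncomputable def cut (B : Finset V) : ℝ := ((edgeBoundary G B).card : ℝ)

/-- Every vertex has `r` neighbours, expressed through the adjacency indicator. -/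
def AdjRegular (r : ℕ) : Prop := ∀ v, ∑ w, adjInd G v w = (r : ℝ)

variable {G}

lemma adjRegular_of_isRegularOfDegree [DecidableRel G.Adj] {r : ℕ}
    (hr : G.IsRegularOfDegree r) : AdjRegular G r := by
  intro v
  rw [← hr v, ← SimpleGraph.card_neighborFinset_eq_degree, SimpleGraph.neighborFinset_eq_filter]
  have h : ∀ w, adjInd G v w = if G.Adj v w then 1 else 0 := fun w => by unfold adjInd; congr
  simp only [h, Finset.sum_boole]

lemma cut_eq_sum (B : Finset V) : cut G B = ∑ u ∈ B, ∑ w ∈ Bᶜ, adjInd G u w := by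
  classical
  rw [cut, edgeBoundary, SimpleGraph.interedges_def, ← Finset.sum_product' (f := adjInd G)]
  simp only [adjInd, Finset.sum_boole]

lemma cut_nonneg (B : Finset V) : 0 ≤ cut G B := Nat.cast_nonneg _

@[simp] lemma cut_empty : cut G ∅ = 0 := by simp [cut_eq_sum]

@[simp] lemma cut_univ : cut G univ = 0 := by simp [cut_eq_sum]

/-- Removing `v` deletes its edges to `Bᶜ` from the cut and adds its edges into `B`; these two
numbers sum to `r`. -/
lemma cut_erase {r : ℕ} (hr : AdjRegular G r) {B : Finset V} {v : V} (hv : v ∈ B) :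
    cut G (B.erase v) = cut G B + r - 2 * ∑ w ∈ Bᶜ, adjInd G v w := by
  have hc : (B.erase v)ᶜ = insert v Bᶜ := by
    ext x; simp only [mem_compl, mem_erase, mem_insert]; tauto
  have h1 : cut G (B.erase v) = ∑ u ∈ B.erase v, (adjInd G u v + ∑ w ∈ Bᶜ, adjInd G u w) := by
    rw [cut_eq_sum, hc]
    refine Finset.sum_congr rfl fun u _ => ?_
    rw [Finset.sum_insert (by simpa using hv)]
  have h2 := Finset.add_sum_erase B (fun u => ∑ w ∈ Bᶜ, adjInd G u w) hv
  have h3 := Finset.add_sum_erase B (fun u => adjInd G u v) hv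
  have h4 := Finset.sum_add_sum_compl B (fun u => adjInd G v u)
  rw [hr v] at h4
  simp only [adjInd_self, zero_add] at h3
  rw [h1, Finset.sum_add_distrib, h3, cut_eq_sum]
  simp only [adjInd_comm _ v] at *
  linarith

lemma exists_adj_of_connected (hG : G.Connected) {B : Finset V} (hB : B.Nonempty)
    (hB' : B ≠ univ) : ∃ v ∈ B, ∃ w ∈ Bᶜ, G.Adj v w := by
  obtain ⟨v, hv⟩ := hB
  obtain ⟨w, hw⟩ : ∃ w, w ∉ B := by
    by_contra! h
    exact hB' (eq_univ_iff_forall.2 h)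
  obtain ⟨p⟩ := hG.preconnected v w
  obtain ⟨d, -, h1, h2⟩ := p.exists_boundary_dart (B : Set V) (by simpa using hv)
    (by simpa using hw)
  exact ⟨d.toProd.1, by simpa using h1, d.toProd.2, by simpa using h2, d.adj⟩

lemma cut_pos_of_connected (hG : G.Connected) {B : Finset V} (hB : B.Nonempty)
    (hB' : B ≠ univ) : 0 < cut G B := by
  obtain ⟨v, hv, w, hw, h⟩ := exists_adj_of_connected hG hB hB'
  rw [cut_eq_sum]
  have h1 := one_le_sum_adjInd hw h
  have h2 := Finset.single_le_sum (f := fun u => ∑ x ∈ Bᶜ, adjInd G u x)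
    (fun u _ => Finset.sum_nonneg fun x _ => adjInd_nonneg u x) hv
  linarith

lemma isoNumber_mul_card_le {B : Finset V} (hB : B.Nonempty)
    (h2 : 2 * B.card ≤ Fintype.card V) : isoNumber G * B.card ≤ cut G B := by
  have hc : (0 : ℝ) < B.card := by exact_mod_cast hB.card_pos
  rw [← le_div_iff₀ hc]
  refine csInf_le ⟨0, ?_⟩ ⟨B, hB, h2, rfl⟩
  rintro x ⟨A, -, -, rfl⟩
  positivity

/-! ### Greedy removal of vertices -/

-- The implication sits inside the existential so that the chosen erasure is a total function, which
-- can be iterated.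
variable (G) in
lemma exists_greedyErase (B : Finset V) : ∃ B' : Finset V,
    (B.Nonempty → ∃ v ∈ B, B' = B.erase v ∧ ∀ w ∈ B, cut G (B.erase v) ≤ cut G (B.erase w)) := by
  by_cases hB : B.Nonempty
  · obtain ⟨v, hv, h⟩ := B.exists_min_image (fun w => cut G (B.erase w)) hB
    exact ⟨B.erase v, fun _ => ⟨v, hv, rfl, h⟩⟩
  · exact ⟨B, fun h => absurd h hB⟩

variable (G) in
/-- Remove from `B` a vertex that makes the remaining cut as small as possible. -/
noncomputable def greedyErase (B : Finset V) : Finset V := (exists_greedyErase G B).choose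

lemma greedyErase_spec {B : Finset V} (hB : B.Nonempty) : ∃ v ∈ B, greedyErase G B = B.erase v ∧
    ∀ w ∈ B, cut G (greedyErase G B) ≤ cut G (B.erase w) := by
  obtain ⟨v, hv, h1, h2⟩ := (exists_greedyErase G B).choose_spec hB
  refine ⟨v, hv, h1, fun w hw => ?_⟩
  rw [greedyErase, h1]
  exact h2 w hw

/-- Some vertex of `B` has a neighbour outside, and the greedy choice is at least as good as
removing that vertex. -/
lemma cut_greedyErase_le_of_connected {r : ℕ} (hr : AdjRegular G r) (hG : G.Connected)
    {B : Finset V} (hB : B.Nonempty) (hB' : B ≠ univ) :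
    cut G (greedyErase G B) ≤ cut G B + r - 2 := by
  obtain ⟨v, hv, w, hw, h⟩ := exists_adj_of_connected hG hB hB'
  obtain ⟨-, -, -, h2⟩ := greedyErase_spec (G := G) hB
  have h3 := h2 v hv
  rw [cut_erase hr hv] at h3
  linarith [one_le_sum_adjInd hw h]

/-- The minimum is at most the average: sum `cut_erase` over `v ∈ B`, where the outgoing edges add
up to the cut itself. -/
lemma card_mul_cut_greedyErase_le {r : ℕ} (hr : AdjRegular G r) {B : Finset V}
    (hB : B.Nonempty) :
    B.card * (cut G (greedyErase G B) - cut G B) ≤ r * B.card - 2 * cut G B := by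
  obtain ⟨-, -, -, h2⟩ := greedyErase_spec (G := G) hB
  have h := Finset.sum_le_sum (s := B) (f := fun _ => cut G (greedyErase G B)) h2
  rw [Finset.sum_congr rfl fun v hv => cut_erase hr hv, Finset.sum_sub_distrib,
    ← Finset.mul_sum, ← cut_eq_sum, Finset.sum_const, Finset.sum_const] at h
  simp only [nsmul_eq_mul] at h
  linarith

variable (G) in
/-- The set left after `k` greedy removals from `B`. -/
noncomputable def greedyChain (B : Finset V) (k : ℕ) : Finset V := (greedyErase G)^[k] B

@[simp] lemma greedyChain_zero (B : Finset V) : greedyChain G B 0 = B := rfl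

lemma greedyChain_succ (B : Finset V) (k : ℕ) :
    greedyChain G B (k + 1) = greedyErase G (greedyChain G B k) :=
  Function.iterate_succ_apply' _ _ _

lemma card_greedyChain (B : Finset V) {k : ℕ} (hk : k ≤ B.card) :
    (greedyChain G B k).card + k = B.card := by
  induction k with
  | zero => simp
  | succ k ih =>
    have ih := ih (by omega)
    have hne : (greedyChain G B k).Nonempty := by rw [← card_pos]; omega
    obtain ⟨v, hv, h1, -⟩ := greedyErase_spec (G := G) hne
    rw [greedyChain_succ, h1, card_erase_of_mem hv]
    omega

lemma greedyChain_nonempty (B : Finset V) {k : ℕ} (hk : k < B.card) :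
    (greedyChain G B k).Nonempty := by
  have := card_greedyChain (G := G) B hk.le
  rw [← card_pos]; omega

lemma greedyChain_card (B : Finset V) : greedyChain G B B.card = ∅ := by
  have := card_greedyChain (G := G) B le_rfl
  rw [← card_eq_zero]; omega

/-- The quantity `r|B| - cut B` is twice the number of edges inside `B`. Averaging keeps a fraction
`(b - 2)/b` of them when one of `b` vertices goes, and the product of these fractions telescopes. -/
lemma cut_greedyChain_le {r : ℕ} (hr : AdjRegular G r) (B : Finset V) {j : ℕ}
    (hj : j ≤ B.card) :
    (cut G (greedyChain G B j) - r * (B.card - j)) * (B.card * (B.card - 1)) ≤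
      (cut G B - r * B.card) * ((B.card - j) * (B.card - j - 1)) := by
  induction j with
  | zero => simp
  | succ j ih =>
    have ih := ih (by omega)
    -- The last removal is separate: there the factor `a - x - 2` multiplying the induction
    -- hypothesis would be negative.
    rcases (show j + 1 = B.card ∨ j + 2 ≤ B.card by omega) with h | h
    · rw [h, greedyChain_card]; simp
    · have hc := card_greedyChain (G := G) B (show j ≤ B.card by omega)
      have hs := card_mul_cut_greedyErase_le hr (greedyChain_nonempty (G := G) B
        (show j < B.card by omega))
      rw [← greedyChain_succ] at hs
      have hc' : ((greedyChain G B j).card : ℝ) = B.card - j := by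
        rw [← hc]; push_cast; ring
      rw [hc'] at hs
      have hb : (j : ℝ) + 2 ≤ B.card := by exact_mod_cast h
      have hj0 : (0 : ℝ) ≤ j := Nat.cast_nonneg j
      push_cast
      generalize (B.card : ℝ) = a at *
      generalize cut G (greedyChain G B j) = D at *
      generalize cut G (greedyChain G B (j + 1)) = D' at *
      generalize cut G B = D₀ at *
      generalize (j : ℝ) = x at *
      have h1 : (a - x) * (D' - r * (a - (x + 1))) ≤ (a - x - 2) * (D - r * (a - x)) := by
        linarith
      have h2 : 0 ≤ a * (a - 1) := mul_nonneg (by linarith) (by linarith)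
      have h3 := mul_le_mul_of_nonneg_right h1 h2
      have h4 := mul_le_mul_of_nonneg_left ih (show 0 ≤ a - x - 2 by linarith)
      have h5 : (a - x) * ((D' - r * (a - (x + 1))) * (a * (a - 1))) ≤
          (a - x) * ((D₀ - r * a) * ((a - (x + 1)) * (a - (x + 1) - 1))) := by
        linarith
      exact le_of_mul_le_mul_left h5 (by linarith)

/-- The growth of the cut along the greedy chain, in terms of a lower bound `i` for the
isoperimetric ratio of the initial set. -/
lemma cut_greedyChain_sub_le {r : ℕ} (hr : AdjRegular G r) (B : Finset V) {i : ℝ}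
    (hi : i * B.card ≤ cut G B) (hB : 2 ≤ B.card) {j : ℕ} (hj : j ≤ B.card) :
    cut G (greedyChain G B j) - cut G B ≤
      j * (r - 2 * i - (r - i) * ((j - 1) / (B.card - 1))) := by
  have h := cut_greedyChain_le hr B hj
  have ha : (2 : ℝ) ≤ B.card := by exact_mod_cast hB
  have hja : (j : ℝ) ≤ B.card := by exact_mod_cast hj
  have hj0 : (0 : ℝ) ≤ j * (2 * B.card - 1 - j) := by
    rcases Nat.eq_zero_or_pos j with rfl | h0
    · simp
    · exact mul_nonneg (Nat.cast_nonneg j) (by linarith)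
  generalize (B.card : ℝ) = a at *
  generalize cut G (greedyChain G B j) = D at *
  generalize cut G B = D₀ at *
  generalize (j : ℝ) = x at *
  have hp : 0 < a * (a - 1) := mul_pos (by linarith) (by linarith)
  have ha1 : a - 1 ≠ 0 := by linarith
  refine le_of_mul_le_mul_right ?_ hp
  have e : x * (r - 2 * i - (r - i) * ((x - 1) / (a - 1))) * (a * (a - 1)) =
      x * a * ((r - 2 * i) * (a - 1) - (r - i) * (x - 1)) := by
    field_simp
  rw [e]
  have h2 := mul_le_mul_of_nonneg_right hi hj0
  linarith

lemma cut_greedyChain_univ_le {r : ℕ} (hr : AdjRegular G r) (hV : 2 ≤ Fintype.card V) {j : ℕ}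
    (hj : j ≤ Fintype.card V) :
    cut G (greedyChain G univ j) ≤
      r * (j * (Fintype.card V - j)) / (Fintype.card V - 1) := by
  have h := cut_greedyChain_sub_le hr (univ : Finset V) (i := 0) (by simp) (by simpa using hV)
    (by simpa using hj)
  simp only [cut_univ, card_univ] at h
  have ha : (2 : ℝ) ≤ Fintype.card V := by exact_mod_cast hV
  have ha1 : (Fintype.card V : ℝ) - 1 ≠ 0 := by linarith
  refine (by simpa using h : _ ≤ _).trans_eq ?_
  field_simp
  ring

end Cut

/-! ### Energy in terms of cuts, and stability levels from greedy paths -/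

section Energy

variable {V : Type*} [Fintype V] [DecidableEq V] {G : SimpleGraph V}

/-- The configuration with spin `s` on `B` and `-s` off `B`. -/
def spinOn (s : ℤˣ) (B : Finset V) : Config V := fun i => if i ∈ B then s else -s

/-- An edge contributes `-1` if it crosses the cut and `1` otherwise; crossing edges, as unordered
pairs, biject with the oriented boundary edges. -/
lemma sum_edgeProd_spinOn (s : ℤˣ) (B : Finset V) [Fintype G.edgeSet] :
    ∑ e ∈ G.edgeFinset, edgeProd (spinOn s B) e = G.edgeFinset.card - 2 * cut G B := by
  classical
  have hs : ((s : ℤ) : ℝ) * ((s : ℤ) : ℝ) = 1 := by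
    rcases Int.units_eq_one_or s with rfl | rfl <;> norm_num
  let P : Sym2 V → Prop := fun e => e ∈ (fun x : V × V => s(x.1, x.2)) '' (B ×ˢ Bᶜ : Finset (V × V))
  have hP : ∀ u v : V, P s(u, v) ↔ (u ∈ B ∧ v ∉ B) ∨ (v ∈ B ∧ u ∉ B) := by
    intro u v
    simp only [P, Set.mem_image, SetLike.mem_coe, mem_product, mem_compl, Prod.exists, Sym2.eq_iff]
    constructor
    · rintro ⟨a, b, ⟨ha, hb⟩, ⟨rfl, rfl⟩ | ⟨rfl, rfl⟩⟩
      · exact Or.inl ⟨ha, hb⟩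
      · exact Or.inr ⟨ha, hb⟩
    · rintro (h | h)
      · exact ⟨u, v, h, Or.inl ⟨rfl, rfl⟩⟩
      · exact ⟨v, u, h, Or.inr ⟨rfl, rfl⟩⟩
  have h1 : ∀ e, edgeProd (spinOn s B) e = 1 - 2 * (if P e then 1 else 0) := by
    intro e
    induction e with
    | _ u v =>
      simp only [hP, edgeProd, Sym2.lift_mk, spinOn]
      by_cases hu : u ∈ B <;> by_cases hv : v ∈ B <;> simp [hu, hv, hs] <;> norm_num
  have h2 : (G.edgeFinset.filter P).card = (edgeBoundary G B).card := by
    symm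
    refine Finset.card_bij (fun x _ => s(x.1, x.2)) ?_ ?_ ?_
    · rintro ⟨u, v⟩ h
      rw [edgeBoundary, SimpleGraph.mem_interedges_iff] at h
      simp only [mem_compl] at h
      rw [mem_filter, hP]
      exact ⟨by simpa using h.2.2, Or.inl ⟨h.1, h.2.1⟩⟩
    · rintro ⟨u, v⟩ h ⟨u', v'⟩ h' he
      rw [edgeBoundary, SimpleGraph.mem_interedges_iff] at h h'
      simp only [mem_compl] at h h'
      rcases Sym2.eq_iff.1 he with ⟨rfl, rfl⟩ | ⟨rfl, rfl⟩
      · rfl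
      · exact absurd h.1 h'.2.1
    · intro e he
      induction e with
      | _ u v =>
        rw [mem_filter, hP] at he
        have hadj : G.Adj u v := by simpa using he.1
        rcases he.2 with h | h
        · exact ⟨(u, v), by
            rw [edgeBoundary, SimpleGraph.mem_interedges_iff]; simpa using ⟨h.1, h.2, hadj⟩, rfl⟩
        · exact ⟨(v, u), by
            rw [edgeBoundary, SimpleGraph.mem_interedges_iff]
            simpa using ⟨h.1, h.2, hadj.symm⟩, Sym2.eq_swap⟩
  rw [Finset.sum_congr rfl fun e _ => h1 e, Finset.sum_sub_distrib, ← Finset.mul_sum,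
    Finset.sum_boole, cut, ← h2]
  simp

lemma sum_spinOn (s : ℤˣ) (B : Finset V) :
    ∑ i, ((spinOn s B i : ℤ) : ℝ) = ((s : ℤ) : ℝ) * (2 * B.card - Fintype.card V) := by
  have h : ∀ i, ((spinOn s B i : ℤ) : ℝ) =
      ((s : ℤ) : ℝ) * (2 * (if i ∈ B then 1 else 0) - 1) := by
    intro i
    unfold spinOn
    split_ifs <;> push_cast <;> ring
  rw [Finset.sum_congr rfl fun i _ => h i, ← Finset.mul_sum, Finset.sum_sub_distrib,
    ← Finset.mul_sum, Finset.sum_boole]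
  simp

lemma energy_spinOn_sub (h : ℝ) (s : ℤˣ) (B C : Finset V) :
    energy G h (spinOn s C) - energy G h (spinOn s B) =
      2 * (cut G C - cut G B) + 2 * h * ((s : ℤ) : ℝ) * (B.card - C.card) := by
  unfold energy
  rw [sum_edgeProd_spinOn, sum_edgeProd_spinOn, sum_spinOn, sum_spinOn]
  ring

lemma hammingDist_spinOn_erase (s : ℤˣ) {B : Finset V} {v : V} (hv : v ∈ B) :
    hammingDist (spinOn s B) (spinOn s (B.erase v)) = 1 := by
  unfold hammingDist
  rw [Finset.card_eq_one]
  refine ⟨v, ?_⟩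
  ext x
  have hs : s ≠ -s := by rcases Int.units_eq_one_or s with rfl | rfl <;> decide
  by_cases hx : x = v
  · subst hx; simp [spinOn, hv, hs]
  · simp [spinOn, hx]

lemma stabilityLevel_le_of_path {h c : ℝ} {σ : Config V} (ω : ℕ → Config V) {ℓ : ℕ}
    (hℓ : 1 ≤ ℓ) (h0 : ω 0 = σ) (hstep : ∀ k < ℓ, hammingDist (ω k) (ω (k + 1)) = 1)
    (hend : energy G h (ω ℓ) < energy G h σ)
    (hc : ∀ k ≤ ℓ, energy G h (ω k) - energy G h σ ≤ c) :
    stabilityLevel G h σ ≤ (c : EReal) := by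
  refine (iInf₂_le (ω ℓ) hend).trans ?_
  have hcomm : commHeight G h σ (ω ℓ) ≤ ((energy G h σ + c : ℝ) : EReal) := by
    refine (iInf_le_of_le ℓ <| iInf_le_of_le (fun k : Fin (ℓ + 1) => ω k) <|
      iInf_le_of_le ⟨hℓ, by simpa using h0, by simp, fun k => by simpa using hstep k k.2⟩ ?_)
    refine iSup_le fun k => ?_
    exact EReal.coe_le_coe_iff.2 (by linarith [hc k (Nat.lt_succ_iff.1 k.2)])
  refine (EReal.sub_le_sub hcomm le_rfl).trans ?_
  rw [← EReal.coe_sub]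
  exact EReal.coe_le_coe_iff.2 (by linarith)

/-- Flipping the spins of `B` in the greedy order bounds the stability level. -/
lemma stabilityLevel_spinOn_le {h c : ℝ} (s : ℤˣ) {B : Finset V} (hB : B.Nonempty)
    (hend : energy G h (spinOn s ∅) < energy G h (spinOn s B))
    (hc : ∀ j ≤ B.card, 2 * (cut G (greedyChain G B j) - cut G B) +
      2 * h * ((s : ℤ) : ℝ) * j ≤ c) :
    stabilityLevel G h (spinOn s B) ≤ (c : EReal) := by
  refine stabilityLevel_le_of_path (fun k => spinOn s (greedyChain G B k)) (ℓ := B.card)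
    hB.card_pos rfl ?_ ?_ ?_
  · intro k hk
    obtain ⟨v, hv, h1, -⟩ := greedyErase_spec (G := G) (greedyChain_nonempty (G := G) B hk)
    simp only [greedyChain_succ, h1]
    exact hammingDist_spinOn_erase s hv
  · simpa only [greedyChain_card] using hend
  · intro k hk
    refine le_trans (le_of_eq ?_) (hc k hk)
    have := card_greedyChain (G := G) B hk
    have h' : ((greedyChain G B k).card : ℝ) = B.card - k := by rw [← this]; push_cast; ring
    rw [energy_spinOn_sub, h']
    ring

lemma spinOn_filter (s : ℤˣ) (σ : Config V) : spinOn s (univ.filter fun i => σ i = s) = σ := by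
  funext i
  simp only [spinOn, mem_filter, mem_univ, true_and]
  split_ifs with hi
  · exact hi.symm
  · rcases Int.units_eq_one_or s with rfl | rfl <;> rcases Int.units_eq_one_or (σ i) with h | h <;>
      simp_all

lemma exists_spinOn (s : ℤˣ) {σ : Config V} (hσ : σ ≠ fun _ => -s) :
    ∃ B : Finset V, B.Nonempty ∧ σ = spinOn s B := by
  refine ⟨univ.filter fun i => σ i = s, ?_, (spinOn_filter s σ).symm⟩
  rw [nonempty_iff_ne_empty]
  intro he
  apply hσ
  rw [← spinOn_filter s σ, he]
  funext i
  simp [spinOn]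

lemma spinOn_compl (s : ℤˣ) (B : Finset V) : spinOn (-s) Bᶜ = spinOn s B := by
  funext i
  by_cases hi : i ∈ B <;> simp [spinOn, hi]

/-- On every regular graph, flipping minus spins in the greedy order reaches the all plus
configuration without raising the energy by more than `r (n + 2) / 2`. -/
lemma stabilityLevel_le_of_regular {r : ℕ} (hr : AdjRegular G r) {h : ℝ} (h0 : 0 < h)
    {σ : Config V} (hσ : σ ≠ allPlus V) :
    stabilityLevel G h σ ≤ (((r : ℝ) / 2 * (Fintype.card V + 2) : ℝ) : EReal) := by
  obtain ⟨B, hB, rfl⟩ := exists_spinOn (-1) (σ := σ) (by rw [neg_neg]; exact hσ)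
  have ha : (1 : ℝ) ≤ B.card := by exact_mod_cast hB.card_pos
  have hn : (B.card : ℝ) ≤ Fintype.card V := by exact_mod_cast card_le_univ B
  have hr0 : (0 : ℝ) ≤ r := Nat.cast_nonneg r
  refine stabilityLevel_spinOn_le (-1) hB ?_ fun j hj => ?_
  · rw [← sub_neg, energy_spinOn_sub]
    have := cut_nonneg (G := G) B
    have := mul_pos h0 (show (0 : ℝ) < B.card by linarith)
    simp
    linarith
  · have hj0 : (0 : ℝ) ≤ j := Nat.cast_nonneg j
    have hja : (j : ℝ) ≤ B.card := by exact_mod_cast hj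
    have hhj := mul_nonneg h0.le hj0
    -- This is the maximum over `x` of `r x (a - x)/(a - 1)`, via `x (a - x) ≤ a²/4` and `a² ≤ (a +
    -- 2)(a - 1)` for `a ≥ 2`.
    have key : cut G (greedyChain G B j) - cut G B ≤ (r : ℝ) / 4 * (B.card + 2) := by
      rcases (show B.card = 1 ∨ 2 ≤ B.card by have := hB.card_pos; omega) with h1 | h2
      · rcases (show j = 0 ∨ j = B.card by omega) with rfl | rfl
        · simp; positivity
        · rw [greedyChain_card]
          have := cut_nonneg (G := G) B
          have : (0 : ℝ) ≤ (r : ℝ) / 4 * (B.card + 2) := by positivity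
          simp; linarith
      · refine (cut_greedyChain_sub_le hr B (i := 0) (by simpa using cut_nonneg B) h2 hj).trans ?_
        have ha2 : (2 : ℝ) ≤ B.card := by exact_mod_cast h2
        generalize (B.card : ℝ) = a at *
        generalize (j : ℝ) = x at *
        have ha1 : (0 : ℝ) < a - 1 := by linarith
        have e : x * (r - 2 * 0 - (r - 0) * ((x - 1) / (a - 1))) =
            r * ((x * (a - x)) / (a - 1)) := by
          field_simp; ring
        rw [e, div_mul_eq_mul_div, mul_div_assoc (r : ℝ) (a + 2)]
        refine mul_le_mul_of_nonneg_left ?_ hr0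
        rw [div_le_div_iff₀ ha1 (by norm_num)]
        nlinarith [sq_nonneg (a - 2 * x)]
    have h4 : (r : ℝ) / 4 * (B.card + 2) ≤ (r : ℝ) / 4 * (Fintype.card V + 2) := by gcongr
    push_cast
    linarith

end Energy

/-! ### Existence of regular graphs -/

/-- The nonzero residues at cyclic distance at most `s` from `0`, and the antipode if `b`. -/
def circulantSet (n s : ℕ) (b : Prop) (x : ℕ) : Prop :=
  (1 ≤ x ∧ x ≤ s) ∨ (n ≤ x + s ∧ x < n) ∨ (b ∧ 2 * x = n)

lemma card_circulantSet {n s : ℕ} {b : Prop} [Decidable b] (hb : b → Even n)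
    (hs : 2 * s + (if b then 1 else 0) < n) :
    open Classical in ((range n).filter (circulantSet n s b)).card =
      2 * s + (if b then 1 else 0) := by
  classical
  have e : (range n).filter (circulantSet n s b) =
      (Icc 1 s ∪ Ico (n - s) n) ∪ (if b then {n / 2} else ∅) := by
    ext x
    simp only [mem_filter, mem_range, circulantSet, mem_union, mem_Icc, mem_Ico]
    by_cases h : b
    · obtain ⟨m, hm⟩ := hb h
      simp only [h, if_true, mem_singleton, true_and] at hs ⊢
      omega
    · simp only [h, if_false, notMem_empty, false_and, or_false] at hs ⊢
      omega
  rw [e, card_union_of_disjoint, card_union_of_disjoint]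
  · have : n - (n - s) = s := by omega
    simp only [Nat.card_Icc, Nat.card_Ico, this]
    split_ifs <;> simp <;> omega
  · rw [disjoint_left]
    intro x h1 h2
    simp only [mem_Icc, mem_Ico] at h1 h2
    omega
  · rw [disjoint_left]
    intro x h1 h2
    by_cases h : b
    · obtain ⟨m, hm⟩ := hb h
      simp only [h, if_true, mem_singleton, mem_union, mem_Icc, mem_Ico] at hs h1 h2
      omega
    · simp [h] at h2

/-- A circulant graph: join residues at cyclic distance at most `r / 2`, and antipodes when `r` is
odd, which forces `n` to be even. -/
lemma regularGraphs_nonempty {n r : ℕ} (hnr : Even (n * r)) (hr : r < n) :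
    (regularGraphs n r).Nonempty := by
  classical
  have : NeZero n := ⟨by omega⟩
  have hrs : r = 2 * (r / 2) + (if Odd r then 1 else 0) := by
    split_ifs with h
    · obtain ⟨k, rfl⟩ := h; omega
    · obtain ⟨k, rfl⟩ := Nat.not_odd_iff_even.1 h; omega
  have hb : Odd r → Even n := fun h => by
    rcases Nat.even_mul.1 hnr with h' | h'
    · exact h'
    · exact absurd h' (Nat.not_even_iff_odd.2 h)
  let P : Fin n → Prop := fun x => circulantSet n (r / 2) (Odd r) x
  have hP0 : ¬ P 0 := by
    simp only [P, circulantSet, Fin.val_zero]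
    have := NeZero.pos n
    omega
  have hPneg : ∀ x, P x → P (-x) := by
    intro x hx
    have hx0 : x ≠ 0 := by rintro rfl; exact hP0 hx
    have hxv : (x : ℕ) ≠ 0 := fun h => hx0 (Fin.ext (by simpa using h))
    have hv : ((-x : Fin n) : ℕ) = n - x := by
      rw [Fin.val_neg']
      exact Nat.mod_eq_of_lt (by omega)
    have := x.2
    clear hP0
    simp only [P, circulantSet, hv] at hx ⊢
    by_cases hodd : Odd r <;> simp only [hodd, true_and, false_and, or_false] at hx ⊢ <;> omega
  let G : SimpleGraph (Fin n) :=
    { Adj := fun u v => P (u - v)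
      symm := ⟨fun u v h => by simpa using hPneg _ h⟩
      loopless := ⟨fun u h => hP0 (by simpa using h)⟩ }
  refine ⟨G, fun v => ?_⟩
  rw [← SimpleGraph.card_neighborFinset_eq_degree, SimpleGraph.neighborFinset_eq_filter]
  have h1 : (univ.filter fun w => G.Adj v w).card = (univ.filter P).card := by
    refine Finset.card_bij (fun w _ => v - w) ?_ ?_ ?_
    · intro w hw
      simpa [G] using hw
    · intro w _ w' _ h
      simpa using h
    · intro x hx
      refine ⟨v - x, ?_, by simp⟩
      simpa [G] using hx
  have h2 : (univ.filter P).card =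
      ((range n).filter (circulantSet n (r / 2) (Odd r))).card := by
    refine Finset.card_bij (fun x _ => (x : ℕ)) ?_ ?_ ?_
    · intro x hx
      simpa [P] using hx
    · intro x _ y _ h
      exact Fin.ext h
    · intro x hx
      rw [mem_filter, mem_range] at hx
      exact ⟨⟨x, hx.1⟩, by simpa [P] using hx.2, rfl⟩
  have h3 := card_circulantSet hb (s := r / 2) (by omega)
  rw [← hrs] at h3
  rw [← h3, ← h2, ← h1]

/-- An event containing every regular graph holds with high probability. -/
lemma whp_of_forall {r : ℕ} {E : (n : ℕ) → Set (SimpleGraph (Fin n))}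
    (hE : ∀ n, regularGraphs n r ⊆ E n) : Whp r E := by
  refine tendsto_const_nhds.congr' ?_
  rw [Filter.EventuallyEq, Filter.eventually_inf_principal]
  filter_upwards [Filter.eventually_gt_atTop r] with n hn heven
  -- Existence of a regular graph matters here: otherwise the quotient would be `0 / 0 = 0`.
  rw [regularProb, Set.inter_eq_left.2 (hE n), div_self]
  have hpos := (Set.ncard_pos (Set.toFinite _)).2 (regularGraphs_nonempty heven hn)
  exact_mod_cast hpos.ne'

lemma whp_stabilityLevel_le {r : ℕ} {h : ℝ} (h0 : 0 < h) :
    Whp r (fun n => {G : SimpleGraph (Fin n) |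
      ∀ σ : Config (Fin n), σ ≠ allMinus (Fin n) → σ ≠ allPlus (Fin n) →
        stabilityLevel G h σ ≤ ((((r : ℝ) / 2 + 1 * √(r : ℝ)) * (n : ℝ) : ℝ) : EReal)}) := by
  classical
  refine whp_of_forall fun n G hG σ _ hσ => ?_
  have hreg : G.IsRegularOfDegree r := hG
  refine (stabilityLevel_le_of_regular (adjRegular_of_isRegularOfDegree hreg) h0 hσ).trans
    (EReal.coe_le_coe_iff.2 ?_)
  rcases Nat.eq_zero_or_pos n with rfl | hn
  · exact absurd (funext fun i => i.elim0) hσ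
  · have hrn : r < n := by
      have := G.degree_lt_card_verts ⟨0, hn⟩
      rwa [hreg, Fintype.card_fin] at this
    -- The excess `r` over `rn/2` is absorbed as `r = √r √r ≤ √r n`.
    have hrn' : √(r : ℝ) ≤ n := by
      rw [Real.sqrt_le_left (by positivity)]
      have h1 : (r : ℝ) ≤ n := by exact_mod_cast hrn.le
      have h2 : (1 : ℝ) ≤ n := by exact_mod_cast hn
      nlinarith
    have h3 := mul_le_mul_of_nonneg_left hrn' (Real.sqrt_nonneg (r : ℝ))
    rw [Real.mul_self_sqrt (Nat.cast_nonneg r)] at h3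
    rw [Fintype.card_fin]
    linarith

/-! ### Upper bounds on the isoperimetric number, and Part 1 -/

section UpperBounds

variable {V : Type*} [Fintype V] [DecidableEq V] {G : SimpleGraph V} {r : ℕ}

lemma cut_greedyChain_le_add_mul (hr : AdjRegular G r) (hG : G.Connected) {B : Finset V}
    (hB : B.card < Fintype.card V) {j : ℕ} (hj : j ≤ B.card) :
    cut G (greedyChain G B j) ≤ cut G B + j * ((r : ℝ) - 2) := by
  induction j with
  | zero => simp
  | succ j ih =>
    have hne := greedyChain_nonempty (G := G) B (show j < B.card by omega)
    have hc := card_greedyChain (G := G) B (show j ≤ B.card by omega)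
    have hu : greedyChain G B j ≠ univ := by
      intro h
      rw [h, card_univ] at hc
      omega
    have h1 := cut_greedyErase_le_of_connected hr hG hne hu
    rw [greedyChain_succ]
    push_cast
    linarith [ih (by omega)]

lemma cut_greedyErase_univ_le (hr : AdjRegular G r) [Nonempty V] :
    cut G (greedyErase G univ) ≤ r := by
  have h := card_mul_cut_greedyErase_le hr (univ_nonempty (α := V))
  have hV : (0 : ℝ) < (univ : Finset V).card := by exact_mod_cast card_pos.2 univ_nonempty
  rw [cut_univ] at h
  refine le_of_mul_le_mul_left ?_ hV
  linarith

lemma card_greedyErase {B : Finset V} (hB : B.Nonempty) :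
    (greedyErase G B).card + 1 = B.card := by
  obtain ⟨v, hv, h1, -⟩ := greedyErase_spec (G := G) hB
  rw [h1, card_erase_add_one hv]

lemma isoNumber_mul_card_le_of_cut_le {A : Finset V} {m : ℕ} {c : ℝ} (hA : A.card = m)
    (hm : 1 ≤ m) (hmV : 2 * m ≤ Fintype.card V) (hc : cut G A ≤ c) : isoNumber G * m ≤ c := by
  subst hA
  exact (isoNumber_mul_card_le (card_pos.1 hm) hmV).trans hc

/-- The averaging bound on the isoperimetric number. -/
lemma isoNumber_mul_le (hr : AdjRegular G r) {m : ℕ} (hm : 1 ≤ m)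
    (hmV : 2 * m ≤ Fintype.card V) :
    isoNumber G * m ≤ r * (m * (Fintype.card V - m)) / (Fintype.card V - 1) := by
  have hc := card_greedyChain (G := G) (univ : Finset V) (k := Fintype.card V - m) (by simp)
  rw [card_univ] at hc
  refine isoNumber_mul_card_le_of_cut_le (A := greedyChain G univ (Fintype.card V - m))
    (by omega) hm hmV ((cut_greedyChain_univ_le hr (by omega) (by omega)).trans_eq ?_)
  rw [Nat.cast_sub (by omega)]
  ring

lemma isoNumber_le_degree (hr : AdjRegular G r) (hV : 2 ≤ Fintype.card V) :
    isoNumber G ≤ r := by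
  have h := isoNumber_mul_le hr le_rfl (by omega)
  have hV' : (2 : ℝ) ≤ Fintype.card V := by exact_mod_cast hV
  have hne : (Fintype.card V : ℝ) - 1 ≠ 0 := by linarith
  simpa [hne] using h

/-- In a connected `2`-regular graph the greedy order produces arcs, with two boundary edges. -/
lemma isoNumber_mul_le_two (hr : AdjRegular G 2) (hG : G.Connected) {m : ℕ} (hm : 1 ≤ m)
    (hmV : 2 * m ≤ Fintype.card V) : isoNumber G * m ≤ 2 := by
  have : Nonempty V := hG.nonempty
  have hc1 := card_greedyErase (G := G) (univ_nonempty (α := V))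
  rw [card_univ] at hc1
  have hc := card_greedyChain (G := G) (greedyErase G (univ : Finset V))
    (k := Fintype.card V - 1 - m) (by omega)
  refine isoNumber_mul_card_le_of_cut_le
    (A := greedyChain G (greedyErase G univ) (Fintype.card V - 1 - m)) (by omega) hm hmV ?_
  have h1 := cut_greedyChain_le_add_mul hr hG (B := greedyErase G univ) (by omega)
    (j := Fintype.card V - 1 - m) (by omega)
  have h2 := cut_greedyErase_univ_le (G := G) hr
  push_cast at h1 h2
  linarith

/-- An odd number of vertices leaves some room below the averaging bound, unless the graph is
complete. -/
lemma isoNumber_mul_le_of_odd (hr : AdjRegular G r) (hG : G.Connected) (hr2 : 2 ≤ r)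
    (heven : Even r) {m : ℕ} (hV : Fintype.card V = 2 * m + 1) (hrm : r < 2 * m) :
    isoNumber G * m ≤ r * (m + 1) / 2 - 1 := by
  have : Nonempty V := hG.nonempty
  have hm : 2 ≤ m := by omega
  set B₁ : Finset V := greedyErase G univ with hB₁
  have hc1 : B₁.card + 1 = 2 * m + 1 := by
    rw [hB₁, card_greedyErase univ_nonempty, card_univ, hV]
  have hne1 : B₁.Nonempty := by rw [← card_pos]; omega
  have hu1 : B₁ ≠ univ := by
    intro h
    rw [h, card_univ] at hc1; omega
  set B₂ : Finset V := greedyErase G B₁ with hB₂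
  have hc2 : B₂.card + 1 = 2 * m := by rw [hB₂, card_greedyErase hne1]; omega
  -- The first two removals take out adjacent vertices, which costs at most `2r - 2`; this beats
  -- pure averaging and makes the bound `hlt` strict.
  have hD1 : cut G B₁ ≤ r := cut_greedyErase_univ_le hr
  have hD2 : cut G B₂ ≤ cut G B₁ + r - 2 := cut_greedyErase_le_of_connected hr hG hne1 hu1
  have hc := card_greedyChain (G := G) B₂ (k := m - 1) (by omega)
  refine isoNumber_mul_card_le_of_cut_le (A := greedyChain G B₂ (m - 1)) (by omega) (by omega)
    (by omega) ?_
  have h := cut_greedyChain_le hr B₂ (j := m - 1) (by omega)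
  have hc2' : (B₂.card : ℝ) = 2 * m - 1 := by
    rw [eq_sub_iff_add_eq]; exact_mod_cast hc2
  rw [hc2', Nat.cast_sub (by omega), Nat.cast_one] at h
  have hm' : (2 : ℝ) ≤ m := by exact_mod_cast hm
  have hrm' : (r : ℝ) < 2 * m := by exact_mod_cast hrm
  have hlt : 2 * cut G (greedyChain G B₂ (m - 1)) < r * (m + 1) := by
    have hle : cut G B₂ - r * (2 * m - 1) ≤ 2 * r - 2 - r * (2 * m - 1) := by linarith
    have h5 := h.trans (mul_le_mul_of_nonneg_right hle
      (by nlinarith : (0 : ℝ) ≤ (2 * m - 1 - (m - 1)) * (2 * m - 1 - (m - 1) - 1)))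
    have hpos : (0 : ℝ) < (2 * m - 1) * (2 * m - 1 - 1) := by nlinarith
    refine lt_of_mul_lt_mul_right ?_ hpos.le
    have h6 : (0 : ℝ) < (2 * m - r) * (m - 1) := mul_pos (by linarith) (by linarith)
    linarith
  -- Since `r` is even, `r(m + 1)/2` is an integer, so the strict inequality gains a full unit.
  obtain ⟨k, rfl⟩ := heven
  rw [cut] at hlt ⊢
  have hlt' : 2 * (edgeBoundary G (greedyChain G B₂ (m - 1))).card < (k + k) * (m + 1) := by
    exact_mod_cast hlt
  have hle' : (edgeBoundary G (greedyChain G B₂ (m - 1))).card + 1 ≤ k * (m + 1) := by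
    have : (k + k) * (m + 1) = 2 * (k * (m + 1)) := by ring
    omega
  have hle'' : ((edgeBoundary G (greedyChain G B₂ (m - 1))).card : ℝ) + 1 ≤ k * (m + 1) := by
    exact_mod_cast hle'
  push_cast
  linarith

lemma degree_add_one_lt_of_ne_top [DecidableRel G.Adj] (hr : G.IsRegularOfDegree r)
    (htop : G ≠ ⊤) : r + 1 < Fintype.card V := by
  obtain ⟨u, v, huv, hadj⟩ : ∃ u v, u ≠ v ∧ ¬G.Adj u v := by
    by_contra! h
    exact htop (by ext u v; exact ⟨fun h' => h'.ne, fun h' => h u v h'⟩)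
  have hsub : G.neighborFinset u ⊆ (univ.erase u).erase v := by
    intro w hw
    rw [SimpleGraph.mem_neighborFinset] at hw
    rw [mem_erase, mem_erase]
    exact ⟨fun h => hadj (h ▸ hw), hw.ne', mem_univ _⟩
  have hc := card_le_card hsub
  rw [SimpleGraph.card_neighborFinset_eq_degree, hr u, card_erase_of_mem (by simp [huv.symm]),
    card_erase_of_mem (mem_univ u), card_univ] at hc
  have h2 : 1 < Fintype.card V := Fintype.one_lt_card_iff.2 ⟨u, v, huv⟩
  rcases Nat.lt_or_ge (Fintype.card V) 3 with h3 | h3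
  · have hr0 : r = 0 := by omega
    omega
  · omega

lemma even_degree_of_odd_card [DecidableRel G.Adj] (hr : G.IsRegularOfDegree r)
    (hodd : Odd (Fintype.card V)) : Even r := by
  have h := G.sum_degrees_eq_twice_card_edges
  simp only [hr.degree_eq, sum_const, card_univ, smul_eq_mul] at h
  have : Even (Fintype.card V * r) := h ▸ even_two_mul _
  rcases Nat.even_mul.1 this with h' | h'
  · exact absurd h' (Nat.not_even_iff_odd.2 hodd)
  · exact h'

lemma degree_of_eq_top [DecidableRel G.Adj] (hr : G.IsRegularOfDegree r) (htop : G = ⊤)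
    [Nonempty V] : r + 1 = Fintype.card V := by
  subst htop
  obtain ⟨v⟩ := ‹Nonempty V›
  have h := hr v
  have h0 : 0 < Fintype.card V := Fintype.card_pos_iff.2 ⟨v⟩
  have h1 : (⊤ : SimpleGraph V).neighborFinset v = univ.erase v := by
    ext w; simp [eq_comm]
  rw [← SimpleGraph.card_neighborFinset_eq_degree, h1, card_erase_of_mem (mem_univ v),
    card_univ] at h
  omega

variable (G r) in
/-- The number of greedy steps `⌈(r + h - 2 i_e) / (r - h) ⋅ n / 2⌉`. -/
noncomputable def stepBound (h : ℝ) : ℤ :=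
  ⌈((r : ℝ) + h - 2 * isoNumber G) / ((r : ℝ) - h) * ((Fintype.card V : ℝ) / 2)⌉

lemma lt_stepBound {h x : ℝ} (hh : h < r)
    (hx : 2 * x * (r - h) < (r + h - 2 * isoNumber G) * Fintype.card V) :
    x < ((r : ℝ) + h - 2 * isoNumber G) / ((r : ℝ) - h) * ((Fintype.card V : ℝ) / 2) := by
  rw [div_mul_eq_mul_div, lt_div_iff₀ (by linarith)]
  linarith

/-- A ceiling is nonnegative once its argument exceeds `-1`. Averaging suffices for even `n`; odd
incomplete graphs need the extra unit of `isoNumber_mul_le_of_odd`; for odd complete graphs what is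
needed is `h(n - 2) > 2`, whence the excluded case. -/
lemma stepBound_nonneg [DecidableRel G.Adj] {h : ℝ} (hreg : G.IsRegularOfDegree r)
    (hG : G.Connected) (hr3 : 3 ≤ r) (h0 : 0 < h) (hi : h < isoNumber G)
    (hexc : ¬ (G = ⊤ ∧ Odd (Fintype.card V) ∧ h * ((Fintype.card V : ℝ) - 2) ≤ 2)) :
    0 ≤ stepBound G r h := by
  have hr := adjRegular_of_isRegularOfDegree hreg
  have : Nonempty V := hG.nonempty
  have hrV : r < Fintype.card V := by
    have := G.degree_lt_card_verts (Classical.arbitrary V)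
    rwa [hreg] at this
  have hhr : h < r := hi.trans_le (isoNumber_le_degree hr (by omega))
  have hr3' : (3 : ℝ) ≤ r := by exact_mod_cast hr3
  refine Int.ceil_nonneg_of_neg_one_lt (lt_stepBound hhr ?_)
  rcases Nat.even_or_odd' (Fintype.card V) with ⟨m, hm | hm⟩
  · have h1 := isoNumber_mul_le hr (m := m) (by omega) (by omega)
    have hm2 : (2 : ℝ) ≤ m := by exact_mod_cast (show 2 ≤ m by omega)
    rw [hm] at h1 ⊢
    push_cast at h1 ⊢
    rw [le_div_iff₀ (by linarith)] at h1
    refine lt_of_mul_lt_mul_right (a := 2 * (m : ℝ) - 1) ?_ (by linarith)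
    have h2 : 0 ≤ h * ((m - 1) * (2 * m - 1)) := by
      refine mul_nonneg h0.le (mul_nonneg ?_ ?_) <;> linarith
    have h3 : 0 < (r : ℝ) * (m - 1) := mul_pos (by linarith) (by linarith)
    linarith
  · have hm1 : 1 ≤ m := by omega
    have hm1' : (1 : ℝ) ≤ m := by exact_mod_cast hm1
    have hh : 0 ≤ h * (m * (2 * m - 1)) := by
      refine mul_nonneg h0.le (mul_nonneg ?_ ?_) <;> linarith
    refine lt_of_mul_lt_mul_right (a := (m : ℝ)) ?_ (by linarith)
    by_cases htop : G = ⊤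
    · have h1 := isoNumber_mul_le hr (m := m) hm1 (by omega)
      have hrm : (r : ℝ) = 2 * m := by
        have := degree_of_eq_top hreg htop
        exact_mod_cast (show r = 2 * m by omega)
      have hexc' : 2 < h * ((Fintype.card V : ℝ) - 2) := by
        by_contra! hle
        exact hexc ⟨htop, ⟨m, hm⟩, hle⟩
      rw [hm] at h1 hexc' ⊢
      push_cast at h1 hexc' ⊢
      rw [hrm] at h1 ⊢
      rw [le_div_iff₀ (by linarith)] at h1
      have h1' : isoNumber G * m ≤ m * (m + 1) := by
        refine le_of_mul_le_mul_right ?_ (show (0 : ℝ) < 2 * m by linarith)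
        linarith
      have h2 := mul_lt_mul_of_pos_left hexc' (show (0 : ℝ) < m by linarith)
      have h3 := mul_le_mul_of_nonneg_right h1' (show (0 : ℝ) ≤ 2 * m + 1 by linarith)
      linarith
    · have hlt := degree_add_one_lt_of_ne_top hreg htop
      have heven := even_degree_of_odd_card hreg ⟨m, hm⟩
      have h1 := isoNumber_mul_le_of_odd hr hG (by omega) heven hm (by omega)
      have hrm : (r : ℝ) < 2 * m := by exact_mod_cast (show r < 2 * m by omega)
      rw [hm]
      push_cast
      have h3 := mul_le_mul_of_nonneg_right h1 (show (0 : ℝ) ≤ 2 * m + 1 by linarith)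
      linarith

/-- The elementary inequality behind the height estimate when the greedy path is long. -/
lemma height_inequality {ρ h i K a x : ℝ} (hρ : 3 ≤ ρ) (h0 : 0 < h) (hhρ : h < ρ)
    (hK : 1 ≤ K) (hKa : (ρ + h - 2 * i) * a ≤ K * (ρ - h))
    (hKx : K + 1 ≤ x) (hxa : x ≤ a) :
    x * (ρ + h - 2 * i - (ρ - i) * ((x - 1) / (a - 1))) ≤ (ρ - 2 + h) * K := by
  have ha : 2 ≤ a := by linarith
  have hd : 0 < ρ - h := by linarith
  obtain ⟨y, hy⟩ : ∃ y, y = (x - 1) / (a - 1) := ⟨_, rfl⟩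
  have hy1 : y ≤ 1 := by rw [hy, div_le_one (by linarith)]; linarith
  have hya : (x - 1) ≤ y * a := by
    have h1 : y * (a - 1) = x - 1 := by rw [hy]; exact div_mul_cancel₀ _ (by linarith)
    have h2 : 0 ≤ y := by rw [hy]; exact div_nonneg (by linarith) (by linarith)
    linarith
  rw [← hy]
  obtain ⟨p, hpdef⟩ : ∃ p, p = ρ + h - 2 * i := ⟨_, rfl⟩
  have hq : ρ - i = (ρ - h + p) / 2 := by rw [hpdef]; ring
  rw [hq, ← hpdef]
  rw [← hpdef] at hKa
  -- Insert `p ≤ K(ρ - h)/a`, then `y ≥ (x - 1)/a`, then `x - 1 ≥ K`.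
  have hbr : (p - (ρ - h + p) / 2 * y) * (2 * a ^ 2) ≤ (ρ - h) * K * (a + 1 - x) := by
    have h1 := mul_le_mul_of_nonneg_right hKa (show 0 ≤ a * (2 - y) by nlinarith)
    have h2 : 0 ≤ (ρ - h) * (a + K) * (y * a - (x - 1)) :=
      mul_nonneg (mul_nonneg hd.le (by linarith)) (by linarith)
    have h3 : 0 ≤ (ρ - h) * a * (x - 1 - K) :=
      mul_nonneg (mul_nonneg hd.le (by linarith)) (by linarith)
    linarith
  -- By AM-GM the product is at most `((a + 1)/2)²`, and `(a + 1)/2 ≤ 3a/4` for `a ≥ 2`.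
  have hx : x * (a + 1 - x) * 16 ≤ 9 * a ^ 2 := by
    nlinarith [sq_nonneg (a + 1 - 2 * x)]
  have hK' : 0 ≤ (ρ - h) * K := mul_nonneg hd.le (by linarith)
  have h4 := mul_le_mul_of_nonneg_left hbr (show 0 ≤ x by linarith)
  have h5 := mul_le_mul_of_nonneg_left hx hK'
  have h6 : 9 * ((ρ - h) * K) ≤ 32 * ((ρ - 2 + h) * K) := by
    -- Degree at least 3 is used here: `23 * 3 > 64`.
    have : 0 ≤ (23 * ρ - 64 + 41 * h) * K := mul_nonneg (by linarith) (by linarith)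
    linarith
  have ha2 : 0 < a ^ 2 := by positivity
  have h7 := mul_le_mul_of_nonneg_right h6 ha2.le
  refine le_of_mul_le_mul_right ?_ (show 0 < 32 * a ^ 2 by linarith)
  linarith

/-! ### Height of the greedy path, by degree -/

lemma greedy_height_of_three_le [DecidableRel G.Adj] {h : ℝ} (hreg : G.IsRegularOfDegree r)
    (hG : G.Connected) (hr3 : 3 ≤ r) (h0 : 0 < h) (hi : h < isoNumber G)
    (hexc : ¬ (G = ⊤ ∧ Odd (Fintype.card V) ∧ h * ((Fintype.card V : ℝ) - 2) ≤ 2))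
    {B : Finset V} (hB : B.Nonempty) (hBV : 2 * B.card ≤ Fintype.card V) {j : ℕ}
    (hj : j ≤ B.card) :
    cut G (greedyChain G B j) - cut G B + h * j ≤ ((r : ℝ) - 2 + h) * stepBound G r h := by
  have hr := adjRegular_of_isRegularOfDegree hreg
  have hB1 := hB.card_pos
  have hhr : h < r := hi.trans_le (isoNumber_le_degree hr (by omega))
  have hr3' : (3 : ℝ) ≤ r := by exact_mod_cast hr3
  have hcoef : 0 ≤ (r : ℝ) - 2 + h := by linarith
  have hD := isoNumber_mul_card_le (G := G) hB hBV
  have hBV' : (2 : ℝ) * B.card ≤ Fintype.card V := by exact_mod_cast hBV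
  rcases le_or_gt ((r : ℝ) + h - 2 * isoNumber G) 0 with hp | hp
  · have hK : (0 : ℝ) ≤ stepBound G r h := by
      exact_mod_cast stepBound_nonneg hreg hG hr3 h0 hi hexc
    have hmono : cut G (greedyChain G B j) + h * j ≤ cut G B := by
      clear hD
      induction j with
      | zero => simp
      | succ j ih =>
        have ih := ih (by omega)
        have hne := greedyChain_nonempty (G := G) B (show j < B.card by omega)
        have hc := card_greedyChain (G := G) B (show j ≤ B.card by omega)
        have h1 := card_mul_cut_greedyErase_le hr hne
        have h2 := isoNumber_mul_card_le (G := G) hne (by omega)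
        rw [greedyChain_succ]
        push_cast
        have hpos : (0 : ℝ) < (greedyChain G B j).card := by exact_mod_cast hne.card_pos
        have h3 : cut G (greedyErase G (greedyChain G B j)) - cut G (greedyChain G B j) ≤ -h := by
          refine le_of_mul_le_mul_left ?_ hpos
          have := mul_nonpos_of_nonpos_of_nonneg hp hpos.le
          linarith
        linarith
    have := mul_nonneg hcoef hK
    linarith
  · have hxpos : 0 < ((r : ℝ) + h - 2 * isoNumber G) / ((r : ℝ) - h) *
        ((Fintype.card V : ℝ) / 2) := by
      refine mul_pos (div_pos hp (by linarith)) ?_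
      have : (1 : ℝ) ≤ B.card := by exact_mod_cast hB1
      linarith
    have hK1 : 1 ≤ stepBound G r h := Int.ceil_pos.2 hxpos
    have hK1' : (1 : ℝ) ≤ stepBound G r h := by exact_mod_cast hK1
    rcases le_or_gt (j : ℤ) (stepBound G r h) with hjK | hjK
    · have h1 := cut_greedyChain_le_add_mul hr hG (B := B) (by omega) hj
      have hjK' : (j : ℝ) ≤ stepBound G r h := by exact_mod_cast hjK
      have := mul_le_mul_of_nonneg_left hjK' hcoef
      linarith
    · have hjK' : (stepBound G r h : ℝ) + 1 ≤ j := by exact_mod_cast hjK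
      have hja : (j : ℝ) ≤ B.card := by exact_mod_cast hj
      have hB2 : 2 ≤ B.card := by
        have : (2 : ℝ) ≤ B.card := by linarith
        exact_mod_cast this
      have hKle : ((r : ℝ) + h - 2 * isoNumber G) / ((r : ℝ) - h) *
        ((Fintype.card V : ℝ) / 2) ≤ stepBound G r h := Int.le_ceil _
      rw [div_mul_eq_mul_div, div_le_iff₀ (by linarith)] at hKle
      have h2 := cut_greedyChain_sub_le hr B hD hB2 hj
      have h3 := height_inequality hr3' h0 hhr (i := isoNumber G) hK1' (a := B.card) (by nlinarith) hjK' hja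
      linarith

lemma greedy_height_of_two [DecidableRel G.Adj] {h : ℝ} (hreg : G.IsRegularOfDegree 2)
    (hG : G.Connected) (h0 : 0 < h) (hi : h < isoNumber G)
    (hexc : ¬ (G = ⊤ ∧ Odd (Fintype.card V) ∧ h * ((Fintype.card V : ℝ) - 2) ≤ 2))
    {B : Finset V} (hB : B.Nonempty) (hBV : 2 * B.card ≤ Fintype.card V) {j : ℕ}
    (hj : j ≤ B.card) :
    cut G (greedyChain G B j) - cut G B + h * j ≤ h * stepBound G 2 h := by
  have hr := adjRegular_of_isRegularOfDegree hreg
  have hB1 := hB.card_pos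
  have : Nonempty V := hG.nonempty
  have hrV : 2 < Fintype.card V := by
    have := G.degree_lt_card_verts (Classical.arbitrary V)
    rwa [hreg] at this
  have hi2 : isoNumber G ≤ 2 := by exact_mod_cast isoNumber_le_degree hr (by omega)
  have hV4 : 4 ≤ Fintype.card V := by
    by_contra! hlt
    have hV3 : Fintype.card V = 3 := by omega
    have htop : G = ⊤ := by
      by_contra htop
      have := degree_add_one_lt_of_ne_top hreg htop
      omega
    refine hexc ⟨htop, by rw [hV3]; decide, ?_⟩
    rw [hV3]; push_cast; linarith
  obtain ⟨m, hm⟩ : ∃ m, m = Fintype.card V / 2 := ⟨_, rfl⟩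
  have him := isoNumber_mul_le_two hr hG (m := m) (by omega) (by omega)
  have hm2 : (2 : ℝ) ≤ m := by exact_mod_cast (show 2 ≤ m by omega)
  have hmV : (2 : ℝ) * m ≤ Fintype.card V := by exact_mod_cast (show 2 * m ≤ _ by omega)
  have hi1 : isoNumber G ≤ 1 := by nlinarith
  have hlt : ((m : ℤ) - 2 : ℤ) < stepBound G 2 h := by
    refine Int.lt_ceil.2 (lt_stepBound (by push_cast; linarith) ?_)
    push_cast
    have h1 := mul_le_mul_of_nonneg_left hmV (show 0 ≤ 2 + h - 2 * isoNumber G by linarith)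
    have h2 := mul_pos h0 (show (0 : ℝ) < m - 1 by linarith)
    linarith
  have hK : (m : ℝ) - 1 ≤ stepBound G 2 h := by
    have : (m : ℤ) - 1 ≤ stepBound G 2 h := by omega
    exact_mod_cast this
  have hhK := mul_le_mul_of_nonneg_left hK h0.le
  -- Only `K ≥ m - 1` is known, so `j = m` is not covered by the step count; it can occur only at
  -- the end of the path, where the cut is empty.
  rcases (show j = B.card ∨ j + 1 ≤ m by omega) with rfl | hjm
  · have hD := isoNumber_mul_card_le (G := G) hB hBV
    have h1 := mul_le_mul_of_nonneg_right hi.le (Nat.cast_nonneg (α := ℝ) B.card)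
    have h2 := mul_nonneg h0.le (show (0 : ℝ) ≤ m - 1 by linarith)
    rw [greedyChain_card, cut_empty]
    linarith
  · have h1 := cut_greedyChain_le_add_mul hr hG (B := B) (by omega) hj
    have hjm' : (j : ℝ) + 1 ≤ m := by exact_mod_cast hjm
    have h2 := mul_le_mul_of_nonneg_left hjm' h0.le
    push_cast at h1
    linarith

/-- Two greedy removals leave a cut of size at most `1 + 1 - 2 = 0`, so by connectivity nothing
remains. -/
lemma card_eq_two_of_regular_one [DecidableRel G.Adj] (hreg : G.IsRegularOfDegree 1)
    (hG : G.Connected) : Fintype.card V = 2 := by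
  have hr := adjRegular_of_isRegularOfDegree hreg
  have : Nonempty V := hG.nonempty
  have hrV : 1 < Fintype.card V := by
    have := G.degree_lt_card_verts (Classical.arbitrary V)
    rwa [hreg] at this
  by_contra hne
  have hc1 := card_greedyErase (G := G) (univ_nonempty (α := V))
  rw [card_univ] at hc1
  have h1 := cut_greedyErase_univ_le (G := G) hr
  have hne1 : (greedyErase G (univ : Finset V)).Nonempty := by rw [← card_pos]; omega
  have hc2 := card_greedyErase (G := G) hne1
  have h2 := cut_greedyErase_le_of_connected hr hG hne1 (by
    intro h; rw [h, card_univ] at hc1; omega)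
  have h3 := cut_pos_of_connected hG (B := greedyErase G (greedyErase G (univ : Finset V)))
    (by rw [← card_pos]; omega) (by intro h; rw [h, card_univ] at hc2; omega)
  push_cast at h1 h2
  linarith

/-- The graph is a single edge with `i_e = 1`; the factor `h - 1` is negative and the step number is
at most `0`, so the product is nonnegative. -/
lemma greedy_height_of_one [DecidableRel G.Adj] {h : ℝ} (hreg : G.IsRegularOfDegree 1)
    (hG : G.Connected) (hi : h < isoNumber G)
    {B : Finset V} (hB : B.Nonempty) (hBV : 2 * B.card ≤ Fintype.card V) {j : ℕ}
    (hj : j ≤ B.card) :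
    cut G (greedyChain G B j) - cut G B + h * j ≤ ((1 : ℕ) - 2 + h) * stepBound G 1 h := by
  have hr := adjRegular_of_isRegularOfDegree hreg
  have hV := card_eq_two_of_regular_one hreg hG
  have hB1 := hB.card_pos
  have hBc : B.card = 1 := by omega
  have hile : isoNumber G ≤ 1 := by exact_mod_cast isoNumber_le_degree hr (by omega)
  have hcut : ∀ A : Finset V, A.Nonempty → 2 * A.card ≤ Fintype.card V → 1 ≤ cut G A := by
    intro A hA hAV
    have hpos := cut_pos_of_connected hG hA (by
      rintro rfl; rw [card_univ] at hAV; omega)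
    rw [cut] at hpos ⊢
    exact_mod_cast hpos
  have hige : 1 ≤ isoNumber G := by
    refine le_csInf ⟨_, B, hB, hBV, rfl⟩ ?_
    rintro x ⟨A, hA, hAV, rfl⟩
    have hA1 := hA.card_pos
    have : A.card = 1 := by omega
    rw [this, Nat.cast_one, div_one]
    exact hcut A hA hAV
  have hK : (stepBound G 1 h : ℝ) ≤ 0 := by
    have : stepBound G 1 h ≤ 0 := by
      refine Int.ceil_le.2 ?_
      have : ((1 : ℕ) + h - 2 * isoNumber G) / ((1 : ℕ) - h) ≤ 0 := by
        push_cast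
        exact div_nonpos_of_nonpos_of_nonneg (by linarith) (by linarith)
      simpa using mul_nonpos_of_nonpos_of_nonneg this (by positivity)
    exact_mod_cast this
  have hrhs : 0 ≤ (((1 : ℕ) : ℝ) - 2 + h) * stepBound G 1 h :=
    mul_nonneg_of_nonpos_of_nonpos (by push_cast; linarith) hK
  rcases (show j = 0 ∨ j = B.card by omega) with rfl | rfl
  · simpa using hrhs
  · have h1 := hcut B hB hBV
    push_cast at hrhs ⊢
    rw [greedyChain_card, cut_empty, hBc, Nat.cast_one]
    linarith

lemma greedy_height [DecidableRel G.Adj] {h : ℝ} (hreg : G.IsRegularOfDegree r)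
    (hG : G.Connected) (h0 : 0 < h) (hi : h < isoNumber G)
    (hexc : ¬ (G = ⊤ ∧ Odd (Fintype.card V) ∧ h * ((Fintype.card V : ℝ) - 2) ≤ 2))
    {B : Finset V} (hB : B.Nonempty) (hBV : 2 * B.card ≤ Fintype.card V) {j : ℕ}
    (hj : j ≤ B.card) :
    cut G (greedyChain G B j) - cut G B + h * j ≤ ((r : ℝ) - 2 + h) * stepBound G r h := by
  have hB1 := hB.card_pos
  have hi0 := isoNumber_le_degree (adjRegular_of_isRegularOfDegree hreg) (by omega)
  rcases (show r = 0 ∨ r = 1 ∨ r = 2 ∨ 3 ≤ r by omega) with rfl | rfl | rfl | h3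
  · push_cast at hi0
    linarith
  · exact greedy_height_of_one hreg hG hi hB hBV hj
  · simpa using greedy_height_of_two hreg hG h0 hi hexc hB hBV hj
  · exact greedy_height_of_three_le hreg hG h3 h0 hi hexc hB hBV hj

/-! ### From heights to stability levels -/

lemma stabilityLevel_spinOn_le_stepBound [DecidableRel G.Adj] {h : ℝ}
    (hreg : G.IsRegularOfDegree r) (hG : G.Connected) (h0 : 0 < h) (hi : h < isoNumber G)
    (hexc : ¬ (G = ⊤ ∧ Odd (Fintype.card V) ∧ h * ((Fintype.card V : ℝ) - 2) ≤ 2))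
    (s : ℤˣ) {B : Finset V} (hB : B.Nonempty) (hBV : 2 * B.card ≤ Fintype.card V) :
    stabilityLevel G h (spinOn s B) ≤
      ((2 * ((r : ℝ) - 2 + h) * stepBound G r h : ℝ) : EReal) := by
  have hs : ((s : ℤ) : ℝ) ≤ 1 := by
    rcases Int.units_eq_one_or s with rfl | rfl <;> norm_num
  refine stabilityLevel_spinOn_le s hB ?_ fun j hj => ?_
  · have hD := isoNumber_mul_card_le (G := G) hB hBV
    have hpos : (0 : ℝ) < B.card := by exact_mod_cast hB.card_pos
    have h1 := mul_lt_mul_of_pos_right hi hpos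
    have h2 := mul_le_mul_of_nonneg_right hs (mul_pos h0 hpos).le
    have h3 := energy_spinOn_sub (G := G) h s B ∅
    rw [cut_empty, card_empty, Nat.cast_zero] at h3
    linarith
  · have h1 := greedy_height hreg hG h0 hi hexc hB hBV hj
    have h2 := mul_le_mul_of_nonneg_right hs (mul_nonneg h0.le (Nat.cast_nonneg (α := ℝ) j))
    linarith

lemma stabilityLevel_le_stepBound [DecidableRel G.Adj] {h : ℝ}
    (hreg : G.IsRegularOfDegree r) (hG : G.Connected) (h0 : 0 < h) (hi : h < isoNumber G)
    (hexc : ¬ (G = ⊤ ∧ Odd (Fintype.card V) ∧ h * ((Fintype.card V : ℝ) - 2) ≤ 2))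
    {σ : Config V} (hm : σ ≠ allMinus V) (hp : σ ≠ allPlus V) :
    stabilityLevel G h σ ≤ ((2 * ((r : ℝ) - 2 + h) * stepBound G r h : ℝ) : EReal) := by
  obtain ⟨B, hB, rfl⟩ := exists_spinOn 1 (σ := σ) hm
  -- Flip whichever spin is in the minority, so that the isoperimetric bound applies to the flipped
  -- set.
  rcases le_or_gt (2 * B.card) (Fintype.card V) with h2 | h2
  · exact stabilityLevel_spinOn_le_stepBound hreg hG h0 hi hexc 1 hB h2
  · have hne : Bᶜ.Nonempty := by
      rw [nonempty_iff_ne_empty, Ne, compl_eq_empty_iff]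
      rintro rfl
      exact hp (by funext i; simp [spinOn, allPlus])
    rw [← spinOn_compl]
    exact stabilityLevel_spinOn_le_stepBound hreg hG h0 hi hexc (-1) hne
      (by rw [card_compl]; omega)

end UpperBounds

end RegularIsing

theorem proposition4p6 :
    (∀ (n r : ℕ) (G : SimpleGraph (Fin n)) [DecidableRel G.Adj] (h : ℝ),
      G.Connected → G.IsRegularOfDegree r →
      0 < h → h < RegularIsing.isoNumber G →
      ¬ (G = ⊤ ∧ Odd n ∧ h * ((n : ℝ) - 2) ≤ 2) →
      ∀ σ : RegularIsing.Config (Fin n),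
        σ ≠ RegularIsing.allMinus (Fin n) → σ ≠ RegularIsing.allPlus (Fin n) →
        RegularIsing.stabilityLevel G h σ ≤
          ((2 * ((r : ℝ) - 2 + h) *
            (⌈((r : ℝ) + h - 2 * RegularIsing.isoNumber G) / ((r : ℝ) - h) *
              ((n : ℝ) / 2)⌉ : ℝ) : ℝ) : EReal)) ∧
    (∃ C₀ : ℝ, 0 < C₀ ∧ ∃ C₂ : ℝ, ∀ (r : ℕ) (h : ℝ),
      3 ≤ r → 0 < h → h < C₀ * √(r : ℝ) →
      RegularIsing.Whp r (fun n => {G : SimpleGraph (Fin n) |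
        ∀ σ : RegularIsing.Config (Fin n),
          σ ≠ RegularIsing.allMinus (Fin n) → σ ≠ RegularIsing.allPlus (Fin n) →
          RegularIsing.stabilityLevel G h σ ≤
            ((((r : ℝ) / 2 + C₂ * √(r : ℝ)) * (n : ℝ) : ℝ) : EReal)})) := by
  refine ⟨?_, 1, one_pos, 1, fun r h _ h0 _ => RegularIsing.whp_stabilityLevel_le h0⟩
  intro n r G _ h hG hreg h0 hi hexc σ hm hp
  have := RegularIsing.stabilityLevel_le_stepBound hreg hG h0 hi (by simpa using hexc) hm hp
  simpa [RegularIsing.stepBound] using this
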